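/- **Setting.** Let $m,r\ge 0$ be integers and let $D\subset\mathbb{R}^m$, $E\subset\mathbb{R}^r$ be compact sets with Lipschitz boundary (near each boundary point, in suitable orthonormal coordinates, the set is the closed region below the graph of a Lipschitz function). Let $C(D\times E)$ be the space of continuous real functions on $D\times E$ with the supremum norm. For $\delta>0$ let $\mathcal{X}_\delta$ be the set of all $\rho\in C(D\times E)$ with $\rho\ge 0$, $\int_{D\times E}\rho(z)\,dz=1$ and $$m_\rho(y):=\int_D\rho(x,y)\,dx\ \ge\ \delta\quad\text{for all }y\in E .$$ The kernel conditioning operator $\mathcal{G}^\star:\mathcal{X}_\delta\to C(D\times E)$ is given by $\mathcal{G}^\star(\rho)(x,y):=\rho(x\,|\,y)=\rho(x,y)/m_\rho(y)$. **Neural operators.** Let $\sigma:\mathbb{R}\to\mathbb{R}$ be a continuous function that is not affine (the nonlinearity), applied componentwise to vectors. A neural network is a map $\mathbb{R}^a\to\mathbb{R}^b$ obtained by composing affine maps alternately with $\sigma$, ending with an affine map and containing at least one application of $\sigma$; depth and widths are arbitrary. A neural operator $\Psi:C(D\times E)\to C(D\times E)$ with activation $\sigma$ and depth $L\ge 1$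 is a composition $\Psi=\mathcal{Q}\circ\mathcal{L}_L\circ\cdots\circ\mathcal{L}_1\circ\mathcal{R}$, for some $d_0,\dots,d_L$, of * a lifting layer $\mathcal{R}:C(D\times E)\to C(D\times E;\mathbb{R}^{d_0})$, $\mathcal{R}(f)(z)=R(z,f(z))$, with a neural network $R:\mathbb{R}^{m+r+1}\to\mathbb{R}^{d_0}$; * hidden layers $\mathcal{L}_\ell:C(D\times E;\mathbb{R}^{d_{\ell-1}})\to C(D\times E;\mathbb{R}^{d_\ell})$, $$\mathcal{L}_\ell(f)(z)=\sigma\Big(W_\ell f(z)+b_\ell+\sum_{k=1}^{M_\ell}\Big(\int_{D\times E}\big(T_{\ell,k}f(w)\big)\cdot\psi_{\ell,k}(w)\,dw\Big)\,\phi_{\ell,k}(z)\Big),$$ with $M_\ell\ge 0$, $W_\ell\in\mathbb{R}^{d_\ell\times d_{\ell-1}}$, $b_\ell\in\mathbb{R}^{d_\ell}$, $T_{\ell,k}\in\mathbb{R}^{d_{\ell-1}\times d_{\ell-1}}$, $\psi_{\ell,k}\in C(D\times E;\mathbb{R}^{d_{\ell-1}})$ and $\phi_{\ell,k}\in C(D\times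 E;\mathbb{R}^{d_\ell})$; * a projection layer $\mathcal{Q}:C(D\times E;\mathbb{R}^{d_L})\to C(D\times E)$, $\mathcal{Q}(f)(z)=Q(z,f(z))$, with a neural network $Q:\mathbb{R}^{m+r+d_L}\to\mathbb{R}$. **Theorem (Approximation of $\mathcal{G}^\star$).** Let $D$, $E$, $\sigma$ be as above, let $\delta>0$ and let $K\subseteq\mathcal{X}_\delta$ be compact in $C(D\times E)$. For every $\varepsilon>0$ there exists a neural operator $\Psi:C(D\times E)\to C(D\times E)$ with activation $\sigma$, of some depth $L\ge 1$, such that $$\sup_{\rho\in K}\big\|\mathcal{G}^\star(\rho)-\Psi(\rho)\big\|_{C(D\times E)}\le\varepsilon .$$ -/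

import Mathlib

noncomputable section

namespace CondOp

open MeasureTheory TopologicalSpace Matrix

/-- `S ⊆ ℝⁿ` has Lipschitz boundary: near every boundary point, in suitable orthonormal
coordinates whose last axis is spanned by the unit vector `v`, the set `S` is the closed region
below the graph of a Lipschitz function `g` of the remaining coordinates. -/
def HasLipschitzBoundary {n : ℕ} (S : Set (EuclideanSpace ℝ (Fin n))) : Prop :=
  ∀ p ∈ frontier S, ∃ v : EuclideanSpace ℝ (Fin n), ‖v‖ = 1 ∧
    ∃ (C : NNReal) (g : (ℝ ∙ v)ᗮ → ℝ), LipschitzWith C g ∧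
      ∃ U ∈ nhds p, ∀ x ∈ U,
        (x ∈ S ↔ inner ℝ v x ≤ g ((ℝ ∙ v)ᗮ.orthogonalProjectionOnto x))

/-- Lebesgue measure on the compact set `D ⊆ ℝⁿ`, as a measure on the subtype. -/
def lebesgueOn {n : ℕ} (D : Compacts (EuclideanSpace ℝ (Fin n))) : Measure D :=
  Measure.comap Subtype.val volume

instance {n : ℕ} (D : Compacts (EuclideanSpace ℝ (Fin n))) :
    IsFiniteMeasure (lebesgueOn D) := by
  refine ⟨?_⟩
  have hD : MeasurableSet (D : Set (EuclideanSpace ℝ (Fin n))) := D.isCompact.measurableSet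
  have h : lebesgueOn D Set.univ = volume (Subtype.val '' (Set.univ : Set D)) :=
    (MeasurableEmbedding.subtype_coe hD).comap_apply _ _
  rw [h]
  refine lt_of_le_of_lt (measure_mono ?_) D.isCompact.measure_lt_top
  rintro _ ⟨x, -, rfl⟩
  exact x.2

section Conditioning

variable {m r : ℕ} (D : Compacts (EuclideanSpace ℝ (Fin m)))
  (E : Compacts (EuclideanSpace ℝ (Fin r)))

/-- Continuous probability densities on `D × E`. -/
def contDensities : Set C(D × E, ℝ) :=
  {ρ | ∫ z, ρ z ∂(lebesgueOn D).prod (lebesgueOn E) = 1 ∧ ∀ z, 0 ≤ ρ z}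

variable {D E} in
/-- The data marginal density `m_ρ(y) = ∫_D ρ(x, y) dx`. -/
def marginal (ρ : C(D × E, ℝ)) (y : E) : ℝ :=
  ∫ x, ρ (x, y) ∂lebesgueOn D

/-- The continuous densities on `D × E` with data marginal bounded below by `δ`. -/
def densitiesGE (δ : ℝ) : Set C(D × E, ℝ) :=
  {ρ | ρ ∈ contDensities D E ∧ ∀ y, δ ≤ marginal ρ y}

variable {D E} in
theorem continuous_marginal (ρ : C(D × E, ℝ)) : Continuous (marginal ρ) := by
  have h := continuous_parametric_integral_of_continuous (μ := lebesgueOn D)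
    (f := fun (y : E) (x : D) => ρ (x, y)) (by fun_prop) isCompact_univ
  simp only [Measure.restrict_univ] at h
  exact h

variable {D E} in
/-- The kernel conditioning operator: it maps a density `ρ` to the kernel function
`(x, y) ↦ ρ(x | y) = ρ(x, y) / m_ρ(y)`. -/
def kernelConditioning {δ : ℝ} (hδ : 0 < δ) (ρ : densitiesGE D E δ) : C(D × E, ℝ) where
  toFun z := ρ.1 z / marginal ρ.1 z.2
  continuous_toFun :=
    ρ.1.continuous.div ((continuous_marginal ρ.1).comp continuous_snd)
      fun z => (lt_of_lt_of_le hδ (ρ.2.2 z.2)).ne'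

end Conditioning

/-- Feedforward neural networks `ℝᵃ → ℝᵇ` with activation `σ` acting componentwise, with at least
one hidden layer, arbitrary depth and widths, and an affine output layer. -/
inductive IsNeuralNetwork (σ : ℝ → ℝ) :
    ∀ {a b : ℕ}, ((Fin a → ℝ) → (Fin b → ℝ)) → Prop
  | shallow {a w b : ℕ} (W : Matrix (Fin w) (Fin a) ℝ) (u : Fin w → ℝ)
      (V : Matrix (Fin b) (Fin w) ℝ) (c : Fin b → ℝ) :
      IsNeuralNetwork σ (fun x : Fin a → ℝ => V *ᵥ (fun i => σ ((W *ᵥ x + u) i)) + c)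
  | deeper {a w b : ℕ} (W : Matrix (Fin w) (Fin a) ℝ) (u : Fin w → ℝ)
      {g : (Fin w → ℝ) → (Fin b → ℝ)} (hg : IsNeuralNetwork σ g) :
      IsNeuralNetwork σ (fun x : Fin a → ℝ => g (fun i => σ ((W *ᵥ x + u) i)))

section NeuralOperator

variable {m r : ℕ} {D : Compacts (EuclideanSpace ℝ (Fin m))}
  {E : Compacts (EuclideanSpace ℝ (Fin r))}

/-- The coordinates in `ℝ^(m + r)` of a point of `D × E`. -/
def coord (z : D × E) : Fin (m + r) → ℝ :=
  Fin.append (z.1 : EuclideanSpace ℝ (Fin m)).ofLp (z.2 : EuclideanSpace ℝ (Fin r)).ofLp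

/-- Lifting layers `f ↦ R(z, f(z))`, for a neural network `R : ℝ^((m + r) + 1) → ℝ^d`. -/
def IsLiftingLayer (σ : ℝ → ℝ) {d : ℕ}
    (lift : C(D × E, ℝ) → C(D × E, Fin d → ℝ)) : Prop :=
  ∃ R : (Fin (m + r + 1) → ℝ) → (Fin d → ℝ), IsNeuralNetwork σ R ∧
    ∀ f z, lift f z = R (Fin.append (coord z) (fun _ : Fin 1 => f z))

/-- Hidden layers
`f ↦ σ(W f(z) + b + ∑ₖ ⟨Tₖ f, ψₖ⟩ φₖ(z))`, where `⟨·, ·⟩` is the `L²` pairing of `ℝᵃ`-valued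
functions on `D × E` and the encoding and decoding functions `ψₖ`, `φₖ` are continuous. -/
def IsHiddenLayer (σ : ℝ → ℝ) {a b : ℕ}
    (hid : C(D × E, Fin a → ℝ) → C(D × E, Fin b → ℝ)) : Prop :=
  ∃ (W : Matrix (Fin b) (Fin a) ℝ) (c : Fin b → ℝ) (M : ℕ)
    (T : Fin M → Matrix (Fin a) (Fin a) ℝ)
    (ψ : Fin M → C(D × E, Fin a → ℝ)) (φ : Fin M → C(D × E, Fin b → ℝ)),
    ∀ f z i, hid f z i = σ ((W *ᵥ f z + c +
      ∑ k, (∫ w, (T k *ᵥ f w) ⬝ᵥ ψ k w ∂(lebesgueOn D).prod (lebesgueOn E)) • φ k z) i)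

/-- Compositions of `L` hidden layers. -/
inductive IsHiddenStack (σ : ℝ → ℝ) :
    ∀ (_ : ℕ) {a b : ℕ}, (C(D × E, Fin a → ℝ) → C(D × E, Fin b → ℝ)) → Prop
  | nil {a : ℕ} : IsHiddenStack σ 0 (id : C(D × E, Fin a → ℝ) → C(D × E, Fin a → ℝ))
  | snoc {L a b c : ℕ} {H : C(D × E, Fin a → ℝ) → C(D × E, Fin b → ℝ)}
      {hid : C(D × E, Fin b → ℝ) → C(D × E, Fin c → ℝ)}
      (hH : IsHiddenStack σ L H) (hhid : IsHiddenLayer σ hid) :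
      IsHiddenStack σ (L + 1) (hid ∘ H)

/-- Projection layers `f ↦ Q(z, f(z))`, for a neural network `Q : ℝ^((m + r) + d) → ℝ`. -/
def IsProjectionLayer (σ : ℝ → ℝ) {d : ℕ}
    (proj : C(D × E, Fin d → ℝ) → C(D × E, ℝ)) : Prop :=
  ∃ Q : (Fin (m + r + d) → ℝ) → (Fin 1 → ℝ), IsNeuralNetwork σ Q ∧
    ∀ f z, proj f z = Q (Fin.append (coord z) (f z)) 0

/-- Neural operators of depth `L > 0` from `C(D × E)` to `C(D × E)`: a lifting layer, followed by
`L` hidden layers, followed by a projection layer. -/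
def IsNeuralOperator (σ : ℝ → ℝ) (L : ℕ) (Ψ : C(D × E, ℝ) → C(D × E, ℝ)) : Prop :=
  0 < L ∧ ∃ (a b : ℕ) (lift : C(D × E, ℝ) → C(D × E, Fin a → ℝ))
    (H : C(D × E, Fin a → ℝ) → C(D × E, Fin b → ℝ))
    (proj : C(D × E, Fin b → ℝ) → C(D × E, ℝ)),
    IsLiftingLayer σ lift ∧ IsHiddenStack σ L H ∧ IsProjectionLayer σ proj ∧
      Ψ = proj ∘ H ∘ lift

end NeuralOperator

end CondOp

end

noncomputable section

namespace CondOp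

open MeasureTheory TopologicalSpace Matrix

/-! ### Uniform approximation on bounded sets by combinations of `t ↦ σ (a * t + b)` -/

/-! The bound `δ` keeps the denominator away from zero, so `(ρ, z) ↦ ρ(z) / m_ρ(y)` is continuous on
the compact space `K × (D × E)`. Stone–Weierstrass applies there to the functions `exp (p · z + ∫ ρ
ψ)`: products stay in the family, so its linear span is an algebra. Coordinates separate points `z`,
and `ψ = ρ - ρ'` separates densities, because Lebesgue measure has full support on sets with
Lipschitz boundary (`exists_sum_exp_near`).

A finite sum of such exponentials is realised approximately at depth one
(`exists_isNeuralOperator_near_sum_exp`): the lifting layer nearly copies `ρ`, the hidden layer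
computes `σ` of affine functions of the integrals `∫ ρ ψⱼ`, and the projection recovers the
integrals, adds `pⱼ · z` and applies a network close to `exp`.

It remains to approximate the identity and `exp` by networks with activation `σ`. Some second
difference of `σ` is nonzero; integrating `σ` twice over a sliding window gives a C² limit with that
number as a second derivative, and rescaled second differences give `t ^ 2` (`ridgeLimit_sq`).
Polarisation gives affine maps, and repeated squaring of `1 + t / 2 ^ n` gives `exp`
(`networkLimit_exp`). -/

/-- The span of the functions `t ↦ σ (a * t + b)`. -/
def ridgeSpan (σ : ℝ → ℝ) : Submodule ℝ (ℝ → ℝ) :=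
  Submodule.span ℝ (Set.range fun (p : ℝ × ℝ) (t : ℝ) => σ (p.1 * t + p.2))

/-- `f` is a limit, uniformly on bounded sets, of elements of `ridgeSpan σ`. -/
def RidgeLimit (σ f : ℝ → ℝ) : Prop :=
  ∀ B ε : ℝ, 0 < ε → ∃ g ∈ ridgeSpan σ, ∀ t, |t| ≤ B → |f t - g t| ≤ ε

theorem ridgeSpan_comp_affine {σ g : ℝ → ℝ} (hg : g ∈ ridgeSpan σ) (a b : ℝ) :
    (fun t => g (a * t + b)) ∈ ridgeSpan σ := by
  refine Submodule.span_induction (p := fun g _ => (fun t => g (a * t + b)) ∈ ridgeSpan σ)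
    ?_ ?_ ?_ ?_ hg
  · rintro _ ⟨⟨c, d⟩, rfl⟩
    refine Submodule.subset_span ⟨(c * a, c * b + d), ?_⟩
    funext t
    simp only
    ring_nf
  · exact (ridgeSpan σ).zero_mem
  · intro x y _ _ hx hy
    exact (ridgeSpan σ).add_mem hx hy
  · intro c x _ hx
    exact (ridgeSpan σ).smul_mem c hx

theorem ridgeSpan_continuous {σ g : ℝ → ℝ} (hσ : Continuous σ) (hg : g ∈ ridgeSpan σ) :
    Continuous g := by
  refine Submodule.span_induction (p := fun g _ => Continuous g) ?_ continuous_const ?_ ?_ hg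
  · rintro _ ⟨p, rfl⟩
    exact hσ.comp (by fun_prop)
  · intro x y _ _ hx hy
    exact hx.add hy
  · intro c x _ hx
    exact hx.const_smul c

namespace RidgeLimit

variable {σ f g : ℝ → ℝ}

theorem of_mem (hf : f ∈ ridgeSpan σ) : RidgeLimit σ f :=
  fun _ _ hε => ⟨f, hf, fun t _ => by simpa using hε.le⟩

theorem self : RidgeLimit σ σ :=
  of_mem (Submodule.subset_span ⟨(1, 0), by funext t; simp⟩)

theorem comp_affine (hf : RidgeLimit σ f) (a b : ℝ) : RidgeLimit σ fun t => f (a * t + b) := by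
  intro B ε hε
  obtain ⟨g, hg, h⟩ := hf (|a| * B + |b|) ε hε
  refine ⟨_, ridgeSpan_comp_affine hg a b, fun t ht => h _ ?_⟩
  calc |a * t + b| ≤ |a * t| + |b| := abs_add_le _ _
    _ ≤ |a| * B + |b| := by rw [abs_mul]; gcongr

theorem limit (h : ∀ B ε : ℝ, 0 < ε → ∃ g, RidgeLimit σ g ∧ ∀ t, |t| ≤ B → |f t - g t| ≤ ε) :
    RidgeLimit σ f := by
  intro B ε hε
  obtain ⟨g, hg, h1⟩ := h B (ε / 2) (by positivity)
  obtain ⟨k, hk, h2⟩ := hg B (ε / 2) (by positivity)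
  refine ⟨k, hk, fun t ht => ?_⟩
  have := abs_sub_le (f t) (g t) (k t)
  linarith [h1 t ht, h2 t ht]

theorem add (hf : RidgeLimit σ f) (hg : RidgeLimit σ g) : RidgeLimit σ fun t => f t + g t := by
  intro B ε hε
  obtain ⟨k, hk, h1⟩ := hf B (ε / 2) (by positivity)
  obtain ⟨l, hl, h2⟩ := hg B (ε / 2) (by positivity)
  refine ⟨k + l, (ridgeSpan σ).add_mem hk hl, fun t ht => ?_⟩
  have h3 := h1 t ht
  have h4 := h2 t ht
  rw [abs_le] at *
  simp only [Pi.add_apply]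
  constructor <;> linarith

theorem const_mul (hf : RidgeLimit σ f) (c : ℝ) : RidgeLimit σ fun t => c * f t := by
  intro B ε hε
  obtain ⟨k, hk, h1⟩ := hf B (ε / (|c| + 1)) (by positivity)
  refine ⟨c • k, (ridgeSpan σ).smul_mem c hk, fun t ht => ?_⟩
  simp only [Pi.smul_apply, smul_eq_mul]
  rw [← mul_sub, abs_mul]
  calc |c| * |f t - k t| ≤ (|c| + 1) * (ε / (|c| + 1)) := by
        gcongr
        · linarith
        · exact h1 t ht
    _ = ε := by field_simp

theorem sum {ι : Type*} (s : Finset ι) {F : ι → ℝ → ℝ} (h : ∀ i ∈ s, RidgeLimit σ (F i)) :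
    RidgeLimit σ fun t => ∑ i ∈ s, F i t := by
  classical
  induction s using Finset.induction_on with
  | empty => exact of_mem (ridgeSpan σ).zero_mem
  | insert i s hi ih =>
    simp only [Finset.sum_insert hi]
    exact (h i (by simp)).add (ih fun j hj => h j (by simp [hj]))

/-- Moving averages of a limit are limits: they are limits of Riemann sums. -/
theorem integral_comp_add (hf : RidgeLimit σ f) (hc : Continuous f) (h : ℝ) :
    RidgeLimit σ fun t => ∫ s in (0 : ℝ)..1, f (t + h * s) := by
  refine limit fun B ε hε => ?_
  have huc : UniformContinuousOn f (Set.Icc (-(B + |h|)) (B + |h|)) :=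
    isCompact_Icc.uniformContinuousOn_of_continuous hc.continuousOn
  obtain ⟨η, hη, hu⟩ := Metric.uniformContinuousOn_iff_le.1 huc ε hε
  -- Within a cell of length `1 / n` the argument of `f` moves by at most `|h| / n < η`.
  obtain ⟨n, hn⟩ := exists_nat_gt (|h| / η)
  have hn0 : (0 : ℝ) < n := lt_of_le_of_lt (by positivity) hn
  refine ⟨fun t => ∑ k ∈ Finset.range n, (1 / n : ℝ) * f (t + h * (k / n)),
    sum _ fun k _ => RidgeLimit.const_mul ?_ _, fun t ht => ?_⟩
  · simpa [add_comm] using hf.comp_affine 1 (h * (k / n))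
  have hsum := intervalIntegral.sum_integral_adjacent_intervals (μ := volume)
    (f := fun s => f (t + h * s)) (a := fun k : ℕ => (k / n : ℝ)) (n := n)
    fun k _ => Continuous.intervalIntegrable (by fun_prop) _ _
  have h01 : ((0 : ℕ) / n : ℝ) = 0 ∧ (n / n : ℝ) = 1 := ⟨by simp, by field_simp⟩
  rw [h01.1, h01.2] at hsum
  rw [← hsum, ← Finset.sum_sub_distrib]
  calc _ ≤ ∑ k ∈ Finset.range n, ε * (1 / n) := ?_
    _ = ε := by simp; field_simp
  refine (Finset.abs_sum_le_sum_abs _ _).trans (Finset.sum_le_sum fun k hk => ?_)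
  have hlen : ((k + 1 : ℕ) / n : ℝ) - k / n = 1 / n := by push_cast; field_simp; ring
  have hconst : (1 / n : ℝ) * f (t + h * (k / n)) =
      ∫ s in (k / n : ℝ)..((k + 1 : ℕ) / n : ℝ), f (t + h * (k / n)) := by
    rw [intervalIntegral.integral_const, hlen, smul_eq_mul]
  rw [hconst, ← intervalIntegral.integral_sub
    (Continuous.intervalIntegrable (by fun_prop) _ _) (by simp)]
  have hkn : (k : ℝ) + 1 ≤ n := by exact_mod_cast Finset.mem_range.1 hk
  have hle : (k / n : ℝ) ≤ ((k + 1 : ℕ) / n : ℝ) := by push_cast; gcongr; linarith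
  have hk1 : ((k + 1 : ℕ) / n : ℝ) ≤ 1 := by
    rw [div_le_one hn0]; push_cast; exact hkn
  have hk0 : (0 : ℝ) ≤ k / n := by positivity
  have hbd : ∀ s : ℝ, 0 ≤ s → s ≤ 1 → t + h * s ∈ Set.Icc (-(B + |h|)) (B + |h|) := by
    intro s hs0 hs1
    rw [Set.mem_Icc, ← abs_le]
    calc |t + h * s| ≤ |t| + |h * s| := abs_add_le _ _
      _ ≤ B + |h| := by
        rw [abs_mul, abs_of_nonneg hs0]
        have := mul_le_mul_of_nonneg_left hs1 (abs_nonneg h)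
        linarith
  rw [← Real.norm_eq_abs]
  refine (intervalIntegral.norm_integral_le_of_norm_le_const (C := ε) fun s hs => ?_).trans ?_
  · rw [Set.uIoc_of_le hle] at hs
    have h1 := hu _ (hbd s (hk0.trans hs.1.le) (hs.2.trans hk1)) _ (hbd (k / n) hk0 (hle.trans hk1)) ?_
    · exact h1
    · rw [Real.dist_eq, show t + h * s - (t + h * (k / n)) = h * (s - k / n) by ring, abs_mul,
        abs_of_nonneg (sub_nonneg.2 hs.1.le)]
      calc |h| * (s - k / n) ≤ |h| * (1 / n) := by gcongr; linarith [hs.2]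
        _ ≤ η := by
          rw [mul_one_div, div_le_iff₀ hn0]
          rw [div_lt_iff₀ hη] at hn
          linarith
  · rw [hlen, abs_of_nonneg (by positivity)]

theorem integral_interval (hf : RidgeLimit σ f) (hc : Continuous f) {h : ℝ} (hh : h ≠ 0) :
    RidgeLimit σ fun t => ∫ s in t..(t + h), f s := by
  convert (hf.integral_comp_add hc h).const_mul h using 2 with t
  have := intervalIntegral.integral_comp_mul_add (a := 0) (b := 1) f hh t
  simp only [mul_zero, zero_add, mul_one, smul_eq_mul] at this
  simp only [add_comm t]
  rw [this]
  field_simp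

end RidgeLimit

/-! ### The square function as a limit -/

theorem affine_of_second_difference_eq_zero {σ : ℝ → ℝ} (hσ : Continuous σ)
    (h : ∀ t u, σ (t + u + u) - σ (t + u) - (σ (t + u) - σ t) = 0) :
    ∃ a b : ℝ, ∀ t, σ t = a * t + b := by
  have hadd : ∀ x y, σ (x + y) - σ 0 = (σ x - σ 0) + (σ y - σ 0) := by
    intro x y
    -- The pairs `0, x + y` and `x, y` share a midpoint, so `σ` has the same sum on both: `σ - σ 0`
    -- is additive, and continuity makes it linear.
    have h1 := h 0 ((x + y) / 2)
    have h2 := h x ((y - x) / 2)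
    rw [show 0 + (x + y) / 2 + (x + y) / 2 = x + y by ring] at h1
    rw [show x + (y - x) / 2 + (y - x) / 2 = y by ring] at h2
    rw [show x + (y - x) / 2 = 0 + (x + y) / 2 by ring] at h2
    linarith
  let A : ℝ →+ ℝ :=
    { toFun := fun x => σ x - σ 0
      map_zero' := by simp
      map_add' := hadd }
  let Lin := A.toRealLinearMap (show Continuous fun x => σ x - σ 0 by fun_prop)
  refine ⟨σ 1 - σ 0, σ 0, fun t => ?_⟩
  have h1 : Lin (t • 1) = t • Lin 1 := map_smul Lin t 1
  have h2 : σ t - σ 0 = t * (σ 1 - σ 0) := by simpa [Lin, A] using h1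
  linarith

theorem hasDerivAt_integral_interval {f : ℝ → ℝ} (hf : Continuous f) (h t : ℝ) :
    HasDerivAt (fun t => ∫ s in t..(t + h), f s) (f (t + h) - f t) t := by
  have hI : ∀ a b, IntervalIntegrable f volume a b := fun a b => hf.intervalIntegrable a b
  have hd : ∀ t, HasDerivAt (fun t => ∫ s in (0 : ℝ)..t, f s) (f t) t := fun t =>
    intervalIntegral.integral_hasDerivAt_right (hI _ _)
      hf.aestronglyMeasurable.stronglyMeasurableAtFilter hf.continuousAt
  have h1 := ((hd (t + h)).comp_add_const t h).sub (hd t)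
  refine h1.congr_of_eventuallyEq (Filter.Eventually.of_forall fun t => ?_)
  exact (intervalIntegral.integral_interval_sub_left (hI _ _) (hI _ _)).symm

/-- A limit with a nonzero second derivative somewhere has `t ↦ t ^ 2` as a rescaled limit of its
symmetric second differences. -/
theorem RidgeLimit.sq_of_hasDerivAt {σ G G' : ℝ → ℝ} (hG : RidgeLimit σ G)
    (h1 : ∀ t, HasDerivAt G (G' t) t) {t₀ c : ℝ} (h2 : HasDerivAt G' c t₀) (hc : c ≠ 0) :
    RidgeLimit σ fun t => t ^ 2 := by
  have ho : (fun x => G' x - G' t₀ - c * (x - t₀)) =o[nhds t₀] fun x => x - t₀ := by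
    have := h2.isLittleO
    simpa [mul_comm] using this
  have hφ : ∀ x ∈ (Set.univ : Set ℝ), HasDerivWithinAt
      (fun x => G x - G' t₀ * (x - t₀) - c * (x - t₀) ^ 2 / 2)
      (G' x - G' t₀ - c * (x - t₀)) Set.univ x := by
    intro x _
    have hid := (hasDerivAt_id x).sub_const t₀
    have := ((h1 x).sub (hid.const_mul (G' t₀))).sub (((hid.pow 2).const_mul c).div_const 2)
    refine (this.congr_deriv ?_).hasDerivWithinAt
    simp only [id, Nat.cast_ofNat]
    ring
  -- Integrating the first-order expansion of `G'` gives the second-order Taylor expansion of `G` at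
  -- `t₀`.
  have hT := convex_univ.isLittleO_pow_succ_real (n := 1) (Set.mem_univ t₀) hφ (by simpa using ho)
  rw [nhdsWithin_univ] at hT
  refine RidgeLimit.limit fun B ε hε => ?_
  set B' := |B| + 1 with hB'
  have hB'0 : 0 < B' := by positivity
  -- Chosen so that the two Taylor remainders at `± k * t` together stay below `ε * |c| * k ^ 2`.
  have hεc : 0 < ε * |c| / (2 * B' ^ 2) := by positivity
  obtain ⟨η, hη, hT⟩ := Metric.eventually_nhds_iff.1 (hT.def hεc)
  set k := η / (2 * B') with hk
  have hk0 : 0 < k := by positivity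
  -- First-order terms cancel in the symmetric difference, leaving `c * k ^ 2 * t ^ 2`. Constants
  -- are not yet known to be limits, so `G t₀` enters as a degenerate rescaling of `G`.
  refine ⟨fun t => (c * k ^ 2)⁻¹ * (G (k * t + t₀) + (G (-k * t + t₀) + (-2) * G (0 * t + t₀))),
    ((hG.comp_affine _ _).add ((hG.comp_affine _ _).add
      ((hG.comp_affine _ _).const_mul _))).const_mul _, fun t ht => ?_⟩
  have htB : |t| ≤ B' := by linarith [le_abs_self B]
  have hT' : ∀ u, |u| = k * |t| → |G (u + t₀) - G t₀ - G' t₀ * u - c * u ^ 2 / 2| ≤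
      ε * |c| / (2 * B' ^ 2) * (k * |t|) ^ 2 := by
    intro u hu
    have := hT (y := u + t₀) ?_
    · simp only [add_sub_cancel_right, sub_self, Real.norm_eq_abs, abs_pow, hu] at this
      refine le_trans (le_of_eq ?_) this
      congr 1
      ring
    · rw [Real.dist_eq, add_sub_cancel_right, hu]
      calc k * |t| ≤ k * B' := by gcongr
        _ = η / 2 := by rw [hk]; field_simp
        _ < η := by linarith
  have e1 := hT' (k * t) (by rw [abs_mul, abs_of_pos hk0])
  have e2 := hT' (-k * t) (by rw [abs_mul, abs_neg, abs_of_pos hk0])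
  have hck : 0 < |c| * k ^ 2 := by positivity
  rw [show t ^ 2 - (c * k ^ 2)⁻¹ * (G (k * t + t₀) + (G (-k * t + t₀) + -2 * G (0 * t + t₀))) =
    -(c * k ^ 2)⁻¹ * ((G (k * t + t₀) - G t₀ - G' t₀ * (k * t) - c * (k * t) ^ 2 / 2) +
      (G (-k * t + t₀) - G t₀ - G' t₀ * (-k * t) - c * (-k * t) ^ 2 / 2)) by
    rw [zero_mul, zero_add]; field_simp; ring]
  rw [abs_mul, abs_neg, abs_inv, abs_mul, abs_of_pos (pow_pos hk0 2), inv_mul_le_iff₀ hck]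
  refine (abs_add_le _ _).trans ((add_le_add e1 e2).trans ?_)
  have : |t| ^ 2 ≤ B' ^ 2 := by gcongr
  calc _ = |c| * k ^ 2 * ε * (|t| ^ 2 / B' ^ 2) := by field_simp; ring
    _ ≤ |c| * k ^ 2 * ε * 1 := by
      gcongr
      rw [div_le_one (by positivity)]
      exact this
    _ = _ := by ring

/-- Each integration over `[t, t + h]` gains a derivative, equal to a difference of the integrand;
after two, the second derivative is the second difference of `σ`. -/
theorem ridgeLimit_sq {σ : ℝ → ℝ} (hσ : Continuous σ)
    (hσ_aff : ¬ ∃ a b : ℝ, ∀ t, σ t = a * t + b) : RidgeLimit σ fun t => t ^ 2 := by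
  obtain ⟨t, h, hth⟩ : ∃ t h, σ (t + h + h) - σ (t + h) - (σ (t + h) - σ t) ≠ 0 := by
    by_contra! hcon
    exact hσ_aff (affine_of_second_difference_eq_zero hσ hcon)
  have hh : h ≠ 0 := by
    rintro rfl
    simp at hth
  have hA := hasDerivAt_integral_interval hσ h
  have hAc : Continuous fun t => ∫ s in t..(t + h), σ s :=
    continuous_iff_continuousAt.2 fun t => (hA t).continuousAt
  refine ((RidgeLimit.self.integral_interval hσ hh).integral_interval hAc hh).sq_of_hasDerivAt
    (hasDerivAt_integral_interval hAc h) (t₀ := t) ?_ hth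
  exact ((hA (t + h)).comp_add_const t h).sub (hA t)

theorem ridgeLimit_affine {σ : ℝ → ℝ} (hsq : RidgeLimit σ fun t => t ^ 2) (a b : ℝ) :
    RidgeLimit σ fun t => a * t + b := by
  have hid : RidgeLimit σ fun t => t := by
    convert (((hsq.comp_affine 1 1).add ((hsq.comp_affine 1 (-1)).const_mul (-1))).const_mul (1 / 4))
      using 2 with t
    ring
  have hone : RidgeLimit σ fun _ => 1 := by
    convert (hid.comp_affine 1 1).add (hid.const_mul (-1)) using 2 with t
    ring
  simpa using (hid.const_mul a).add (hone.const_mul b)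

/-! ### Neural networks -/

section Networks

variable {σ : ℝ → ℝ}

theorem IsNeuralNetwork.comp_affine {a a' b : ℕ} {g : (Fin a → ℝ) → (Fin b → ℝ)}
    (hg : IsNeuralNetwork σ g) (W : Matrix (Fin a) (Fin a') ℝ) (u : Fin a → ℝ) :
    IsNeuralNetwork σ fun x => g (W *ᵥ x + u) := by
  cases hg with
  | shallow W' u' V c =>
    convert IsNeuralNetwork.shallow (σ := σ) (W' * W) (W' *ᵥ u + u') V c using 5
    rw [mulVec_add, mulVec_mulVec, add_assoc]
  | deeper W' u' hg =>
    convert IsNeuralNetwork.deeper (W' * W) (W' *ᵥ u + u') hg using 5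
    rw [mulVec_add, mulVec_mulVec, add_assoc]

theorem IsNeuralNetwork.affine_comp {a b b' : ℕ} {g : (Fin a → ℝ) → (Fin b → ℝ)}
    (hg : IsNeuralNetwork σ g) (V : Matrix (Fin b') (Fin b) ℝ) (c : Fin b' → ℝ) :
    IsNeuralNetwork σ fun x => V *ᵥ g x + c := by
  induction hg with
  | shallow W' u' V' c' =>
    convert IsNeuralNetwork.shallow (σ := σ) W' u' (V * V') (V *ᵥ c' + c) using 2
    rw [mulVec_add, mulVec_mulVec, add_assoc]
  | deeper W' u' hg ih => exact .deeper W' u' (ih V)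

/-- The output affine map of `f` is absorbed into the first affine map of `g`. -/
theorem IsNeuralNetwork.comp {a b c : ℕ} {g : (Fin b → ℝ) → (Fin c → ℝ)}
    {f : (Fin a → ℝ) → (Fin b → ℝ)} (hg : IsNeuralNetwork σ g) (hf : IsNeuralNetwork σ f) :
    IsNeuralNetwork σ fun x => g (f x) := by
  induction hf with
  | shallow W u V d => exact .deeper W u (hg.comp_affine V d)
  | deeper W u _ ih => exact .deeper W u (ih hg)

/-- `f`, applied to each coordinate, can be approximated by neural networks. -/
def NetworkLimit (σ f : ℝ → ℝ) : Prop :=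
  ∀ (N : ℕ) (B ε : ℝ), 0 < ε → ∃ g : (Fin N → ℝ) → (Fin N → ℝ), IsNeuralNetwork σ g ∧
    ∀ x, (∀ i, |x i| ≤ B) → ∀ i, |f (x i) - g x i| ≤ ε

theorem exists_sum_of_mem_ridgeSpan {g : ℝ → ℝ} (hg : g ∈ ridgeSpan σ) :
    ∃ (n : ℕ) (c a b : Fin n → ℝ), ∀ t, g t = ∑ i, c i * σ (a i * t + b i) := by
  obtain ⟨n, c, p, rfl⟩ := Submodule.mem_span_set'.1 hg
  choose q hq using fun i => (p i).2
  refine ⟨n, c, fun i => (q i).1, fun i => (q i).2, fun t => ?_⟩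
  simp [← hq]

theorem isNeuralNetwork_of_mem_ridgeSpan {g : ℝ → ℝ} (hg : g ∈ ridgeSpan σ) (N : ℕ) :
    IsNeuralNetwork σ fun (x : Fin N → ℝ) i => g (x i) := by
  obtain ⟨n, c, a, b, hg⟩ := exists_sum_of_mem_ridgeSpan hg
  -- One hidden unit for each pair of a coordinate and a summand of `g`.
  let e := (finProdFinEquiv (m := N) (n := n)).symm
  convert IsNeuralNetwork.shallow (σ := σ)
    (Matrix.of fun (k : Fin (N * n)) (j : Fin N) => if (e k).1 = j then a (e k).2 else 0)
    (fun k => b (e k).2)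
    (Matrix.of fun (i : Fin N) (k : Fin (N * n)) => if (e k).1 = i then c (e k).2 else 0) 0
    using 3 with x i
  rw [hg, Pi.add_apply, Pi.zero_apply, add_zero]
  simp only [mulVec, dotProduct, Matrix.of_apply, Pi.add_apply, ite_mul, zero_mul,
    Finset.sum_ite_eq, Finset.mem_univ, if_true]
  rw [e.sum_comp fun p : Fin N × Fin n => if p.1 = i then c p.2 * σ (a p.2 * x p.1 + b p.2) else 0,
    Fintype.sum_prod_type]
  rw [Finset.sum_eq_single i]
  · simp
  · intro j _ hj
    simp [hj]
  · simp

namespace NetworkLimit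

variable {f g : ℝ → ℝ}

theorem of_ridgeLimit (hf : RidgeLimit σ f) : NetworkLimit σ f := by
  intro N B ε hε
  obtain ⟨g, hg, h⟩ := hf B ε hε
  exact ⟨_, isNeuralNetwork_of_mem_ridgeSpan hg N, fun x hx i => h _ (hx i)⟩

theorem comp (hf : NetworkLimit σ f) (hg : NetworkLimit σ g) (hfc : Continuous f)
    (hgc : Continuous g) : NetworkLimit σ fun t => f (g t) := by
  intro N B ε hε
  obtain ⟨C, hC⟩ := (isCompact_Icc (a := -B) (b := B)).exists_bound_of_continuousOn hgc.continuousOn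
  have huc : UniformContinuousOn f (Set.Icc (-(C + 1)) (C + 1)) :=
    isCompact_Icc.uniformContinuousOn_of_continuous hfc.continuousOn
  obtain ⟨η, hη, hu⟩ := Metric.uniformContinuousOn_iff_le.1 huc (ε / 2) (by positivity)
  -- The bound `η` serves the modulus of continuity of `f`; the bound `1` keeps `k x` in the
  -- enlarged interval.
  obtain ⟨k, hk, hkb⟩ := hg N B (min η 1) (by positivity)
  obtain ⟨l, hl, hlb⟩ := hf N (C + 1) (ε / 2) (by positivity)
  refine ⟨_, hl.comp hk, fun x hx i => ?_⟩
  have hgx : ∀ i, |g (x i)| ≤ C := fun i => hC _ (abs_le.1 (hx i))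
  have hkx : ∀ i, |k x i| ≤ C + 1 := fun i => by
    have h1 := (hkb x hx i).trans (min_le_right _ _)
    have h2 := hgx i
    rw [abs_le] at *
    constructor <;> linarith
  have h1 := hu (g (x i)) (abs_le.1 ((hgx i).trans (by linarith))) (k x i) (abs_le.1 (hkx i))
    ((hkb x hx i).trans (min_le_left _ _))
  have h2 := hlb (k x) hkx i
  rw [Real.dist_eq] at h1
  have h3 := abs_sub_le (f (g (x i))) (f (k x i)) (l (k x) i)
  linarith

theorem limit (h : ∀ B ε : ℝ, 0 < ε → ∃ g, NetworkLimit σ g ∧ ∀ t, |t| ≤ B → |f t - g t| ≤ ε) :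
    NetworkLimit σ f := by
  intro N B ε hε
  obtain ⟨g, hg, h1⟩ := h B (ε / 2) (by positivity)
  obtain ⟨k, hk, h2⟩ := hg N B (ε / 2) (by positivity)
  refine ⟨k, hk, fun x hx i => ?_⟩
  have := abs_sub_le (f (x i)) (g (x i)) (k x i)
  linarith [h1 _ (hx i), h2 x hx i]

theorem pow_two_pow (hsq : RidgeLimit σ fun t => t ^ 2) (a b : ℝ) (n : ℕ) :
    NetworkLimit σ fun t => (a * t + b) ^ 2 ^ n := by
  induction n with
  | zero => simpa using of_ridgeLimit (ridgeLimit_affine hsq a b)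
  | succ n ih =>
    convert (of_ridgeLimit hsq).comp ih (by fun_prop) (by fun_prop) using 2 with t
    rw [← pow_mul, pow_succ]

end NetworkLimit

/-- Compare `n`-th powers of `exp (t / n)` and `1 + t / n`: the bases differ by at most `(t / n) ^
2`, and both are at most `exp (|t| / n)` in absolute value. -/
theorem abs_exp_sub_one_add_div_pow_le {t : ℝ} {n : ℕ} (hn : 0 < n) (ht : |t| ≤ n) :
    |Real.exp t - (1 + t / n) ^ n| ≤ t ^ 2 * Real.exp |t| / n := by
  have hn0 : (0 : ℝ) < n := by exact_mod_cast hn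
  have habs : |t / n| = |t| / n := by rw [abs_div, abs_of_pos hn0]
  have h1 : |t / n| ≤ 1 := by rw [habs, div_le_one hn0]; exact ht
  have hexp : Real.exp t = Real.exp (t / n) ^ n := by
    rw [← Real.exp_nat_mul]
    congr 1
    field_simp
  have hmax : max |Real.exp (t / n)| |1 + t / n| ≤ Real.exp (|t| / n) := by
    rw [max_le_iff, abs_of_pos (Real.exp_pos _), ← habs]
    refine ⟨Real.exp_le_exp.2 (le_abs_self _), (abs_add_le _ _).trans ?_⟩
    rw [abs_one, add_comm]
    exact Real.add_one_le_exp _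
  have hpow : max |Real.exp (t / n)| |1 + t / n| ^ (n - 1) ≤ Real.exp |t| := by
    calc _ ≤ Real.exp (|t| / n) ^ (n - 1) := by gcongr
      _ ≤ Real.exp (|t| / n) ^ n :=
        pow_le_pow_right₀ (Real.one_le_exp (by positivity)) (Nat.sub_le _ _)
      _ = Real.exp |t| := by
        rw [← Real.exp_nat_mul]
        congr 1
        field_simp
  rw [hexp]
  calc _ ≤ |Real.exp (t / n) - (1 + t / n)| * n * max |Real.exp (t / n)| |1 + t / n| ^ (n - 1) :=
        abs_pow_sub_pow_le _ _ _
    _ ≤ (t / n) ^ 2 * n * Real.exp |t| := by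
        have := Real.abs_exp_sub_one_sub_id_le h1
        rw [sub_sub] at this
        gcongr
    _ = t ^ 2 * Real.exp |t| / n := by field_simp

theorem networkLimit_exp (hsq : RidgeLimit σ fun t => t ^ 2) : NetworkLimit σ Real.exp := by
  refine NetworkLimit.limit fun B ε hε => ?_
  obtain ⟨n, hn⟩ := exists_nat_gt (|B| + B ^ 2 * Real.exp |B| / ε)
  have hn2 : (n : ℝ) ≤ (2 ^ n : ℕ) := by exact_mod_cast Nat.lt_two_pow_self.le
  have hpos : (0 : ℝ) < (2 ^ n : ℕ) := by positivity
  refine ⟨_, NetworkLimit.pow_two_pow hsq (1 / (2 ^ n : ℕ)) 1 n, fun t ht => ?_⟩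
  have htB : |t| ≤ |B| := ht.trans (le_abs_self B)
  have h0 : 0 ≤ B ^ 2 * Real.exp |B| / ε := by positivity
  have := abs_exp_sub_one_add_div_pow_le (t := t) (n := 2 ^ n) (by positivity) (by linarith)
  rw [show 1 / ((2 ^ n : ℕ) : ℝ) * t + 1 = 1 + t / (2 ^ n : ℕ) by ring]
  refine this.trans ?_
  rw [div_le_iff₀ hpos]
  calc t ^ 2 * Real.exp |t| ≤ B ^ 2 * Real.exp |B| :=
        mul_le_mul (sq_le_sq.2 htB) (Real.exp_le_exp.2 htB) (by positivity) (by positivity)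
    _ = ε * (B ^ 2 * Real.exp |B| / ε) := by field_simp
    _ ≤ ε * (2 ^ n : ℕ) := by
        gcongr
        linarith [abs_nonneg B]

end Networks

/-! ### Full support of Lebesgue measure on sets with Lipschitz boundary -/

/-- Moving a boundary point of `S` along `-v` leaves its projection fixed and lowers its height, so
it lands strictly below the graph, hence in the interior. -/
theorem HasLipschitzBoundary.subset_closure_interior {n : ℕ} {S : Set (EuclideanSpace ℝ (Fin n))}
    (hS : HasLipschitzBoundary S) : S ⊆ closure (interior S) := by
  intro p hp
  by_cases hpi : p ∈ interior S
  · exact subset_closure hpi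
  obtain ⟨v, hv, C, g, hg, U, hU, hUS⟩ := hS p ⟨subset_closure hp, hpi⟩
  have hpg := (hUS p (mem_of_mem_nhds hU)).1 hp
  have hline : Filter.Tendsto (fun s : ℝ => p - s • v) (nhdsWithin 0 (Set.Ioi 0)) (nhds p) := by
    have : Continuous fun s : ℝ => p - s • v := by fun_prop
    simpa using (this.tendsto 0).mono_left nhdsWithin_le_nhds
  refine mem_closure_of_tendsto hline ?_
  filter_upwards [hline (interior_mem_nhds.2 hU), self_mem_nhdsWithin] with s hsU hs
  have hopen : IsOpen {x : EuclideanSpace ℝ (Fin n) |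
      inner ℝ v x < g ((ℝ ∙ v)ᗮ.orthogonalProjectionOnto x)} :=
    isOpen_lt (by fun_prop) (hg.continuous.comp (by fun_prop))
  refine mem_interior.2 ⟨_, fun x hx => (hUS x (interior_subset hx.1)).2 (le_of_lt hx.2),
    isOpen_interior.inter hopen, hsU, ?_⟩
  have hproj : (ℝ ∙ v)ᗮ.orthogonalProjectionOnto v = 0 :=
    Submodule.orthogonalProjectionOnto_orthogonal_apply_eq_zero
      (Submodule.mem_span_singleton_self v)
  simp only [Set.mem_ofPred_eq, map_sub, map_smul, hproj, smul_zero, sub_zero, inner_sub_right,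
    inner_smul_right, real_inner_self_eq_norm_sq, hv]
  have : 0 < s := hs
  linarith

theorem isOpenPosMeasure_lebesgueOn {n : ℕ} (D : Compacts (EuclideanSpace ℝ (Fin n)))
    (hD : HasLipschitzBoundary (D : Set (EuclideanSpace ℝ (Fin n)))) :
    (lebesgueOn D).IsOpenPosMeasure := by
  refine ⟨fun U hU ⟨p, hp⟩ => ?_⟩
  obtain ⟨O, hO, rfl⟩ := isOpen_induced_iff.1 hU
  have h : lebesgueOn D (Subtype.val ⁻¹' O) = volume (Subtype.val '' (Subtype.val ⁻¹' O : Set D)) :=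
    (MeasurableEmbedding.subtype_coe D.isCompact.measurableSet).comap_apply _ _
  rw [h]
  have hne : (O ∩ interior (D : Set (EuclideanSpace ℝ (Fin n)))).Nonempty :=
    mem_closure_iff.1 (hD.subset_closure_interior p.2) O hO hp
  refine ((hO.inter isOpen_interior).measure_pos volume hne).ne' ∘ fun h0 => ?_
  refine measure_mono_null ?_ h0
  rintro x ⟨hxO, hxD⟩
  exact ⟨⟨x, interior_subset hxD⟩, hxO, rfl⟩

/-! ### Density of exponentials in positions and linear functionals -/

section Density

variable {m r : ℕ} {D : Compacts (EuclideanSpace ℝ (Fin m))}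
  {E : Compacts (EuclideanSpace ℝ (Fin r))}

variable (D E) in
/-- Lebesgue measure on `D × E`. -/
abbrev lebesgueProd : Measure (D × E) := (lebesgueOn D).prod (lebesgueOn E)

theorem continuous_coord : Continuous (coord : D × E → Fin (m + r) → ℝ) := by
  refine continuous_pi fun i => ?_
  refine Fin.addCases (fun i => ?_) (fun i => ?_) i
  · simp only [coord, Fin.append_left]
    fun_prop
  · simp only [coord, Fin.append_right]
    fun_prop

theorem coord_injective : Function.Injective (coord : D × E → Fin (m + r) → ℝ) := by
  intro z z' h
  refine Prod.ext (Subtype.ext ?_) (Subtype.ext ?_)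
  · ext i
    simpa [coord] using congrFun h (Fin.castAdd r i)
  · ext i
    simpa [coord] using congrFun h (Fin.natAdd m i)

theorem integrable_of_continuous {f : D × E → ℝ} (hf : Continuous f) :
    Integrable f (lebesgueProd D E) := by
  simpa using hf.continuousOn.integrableOn_compact (μ := lebesgueProd D E) isCompact_univ

theorem continuous_integral_mul (K : Set C(D × E, ℝ)) [CompactSpace K] (ψ : C(D × E, ℝ)) :
    Continuous fun ρ : K => ∫ w, ρ.1 w * ψ w ∂lebesgueProd D E := by
  have h := continuous_parametric_integral_of_continuous (μ := lebesgueProd D E)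
    (f := fun (ρ : K) (w : D × E) => ρ.1 w * ψ w) (by fun_prop) isCompact_univ
  simpa using h

/-- The function `(ρ, z) ↦ exp (p · z + ∫ ρ ψ)` on `K × (D × E)`. -/
def expFun (K : Set C(D × E, ℝ)) [CompactSpace K]
    (p : (Fin (m + r) → ℝ) × C(D × E, ℝ)) : C(K × (D × E), ℝ) where
  toFun q := Real.exp (p.1 ⬝ᵥ coord q.2 + ∫ w, q.1.1 w * p.2 w ∂lebesgueProd D E)
  continuous_toFun := by
    have h1 := (continuous_integral_mul K p.2).comp (continuous_fst (X := K) (Y := D × E))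
    have h2 := (continuous_coord (D := D) (E := E)).comp (continuous_snd (X := K) (Y := D × E))
    have h3 : Continuous fun q : K × (D × E) => p.1 ⬝ᵥ coord q.2 := continuous_const.dotProduct h2
    exact Real.continuous_exp.comp (h3.add h1)

theorem expFun_mul (K : Set C(D × E, ℝ)) [CompactSpace K]
    (p p' : (Fin (m + r) → ℝ) × C(D × E, ℝ)) :
    expFun K p * expFun K p' = expFun K (p + p') := by
  ext q
  simp only [expFun, ContinuousMap.mul_apply, ContinuousMap.coe_mk, ← Real.exp_add, Prod.fst_add,
    Prod.snd_add, ContinuousMap.add_apply, add_dotProduct, mul_add]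
  rw [integral_add (integrable_of_continuous (by fun_prop))
    (integrable_of_continuous (by fun_prop))]
  congr 1
  ring

theorem expFun_zero (K : Set C(D × E, ℝ)) [CompactSpace K] : expFun K 0 = 1 := by
  ext q
  simp [expFun]

/-- The algebra spanned by the functions `expFun K p`. -/
def expAlgebra (K : Set C(D × E, ℝ)) [CompactSpace K] : Subalgebra ℝ C(K × (D × E), ℝ) :=
  (Submodule.span ℝ (Set.range (expFun K))).toSubalgebra
    (Submodule.subset_span ⟨0, expFun_zero K⟩) (by
      intro x y hx hy
      refine Submodule.span_induction₂ (p := fun x y _ _ => x * y ∈ _) ?_ ?_ ?_ ?_ ?_ ?_ ?_ hx hy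
      · rintro _ _ ⟨p, rfl⟩ ⟨p', rfl⟩
        exact Submodule.subset_span ⟨p + p', (expFun_mul K p p').symm⟩
      · intro y _
        simp
      · intro x _
        simp
      · intro x y z _ _ _ h1 h2
        rw [add_mul]
        exact Submodule.add_mem _ h1 h2
      · intro x y z _ _ _ h1 h2
        rw [mul_add]
        exact Submodule.add_mem _ h1 h2
      · intro c x y _ _ h
        rw [smul_mul_assoc]
        exact Submodule.smul_mem _ c h
      · intro c x y _ _ h
        rw [mul_smul_comm]
        exact Submodule.smul_mem _ c h)

theorem expAlgebra_separatesPoints (hD : HasLipschitzBoundary (D : Set (EuclideanSpace ℝ (Fin m))))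
    (hE : HasLipschitzBoundary (E : Set (EuclideanSpace ℝ (Fin r)))) (K : Set C(D × E, ℝ))
    [CompactSpace K] : (expAlgebra K).SeparatesPoints := by
  rintro ⟨ρ, z⟩ ⟨ρ', z'⟩ hne
  by_contra! hcon
  have hall : ∀ p, expFun K p (ρ, z) = expFun K p (ρ', z') := fun p =>
    hcon _ ⟨_, Submodule.subset_span ⟨p, rfl⟩, rfl⟩
  refine hne (Prod.ext (Subtype.ext ?_) (coord_injective ?_))
  · have := isOpenPosMeasure_lebesgueOn D hD
    have := isOpenPosMeasure_lebesgueOn E hE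
    -- This choice of `ψ` yields `∫ (ρ - ρ') ^ 2 = 0`; full support then forces `ρ = ρ'`.
    have h := Real.exp_injective (hall (0, ρ.1 - ρ'.1))
    simp only [zero_dotProduct, zero_add] at h
    rw [← sub_eq_zero, ← integral_sub (integrable_of_continuous (by fun_prop))
      (integrable_of_continuous (by fun_prop))] at h
    have hc : Continuous fun w => (ρ.1 w - ρ'.1 w) * (ρ.1 w - ρ'.1 w) := by fun_prop
    simp only [← sub_mul, ContinuousMap.sub_apply] at h
    rw [integral_eq_zero_iff_of_nonneg (fun w => mul_self_nonneg _)
      (integrable_of_continuous hc), hc.ae_eq_iff_eq _ continuous_zero] at h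
    ext w
    have := congrFun h w
    simpa [sub_eq_zero] using this
  · funext i
    have h := Real.exp_injective (hall (Pi.single i 1, 0))
    simpa using h

theorem exists_sum_exp_near (hD : HasLipschitzBoundary (D : Set (EuclideanSpace ℝ (Fin m))))
    (hE : HasLipschitzBoundary (E : Set (EuclideanSpace ℝ (Fin r)))) {K : Set C(D × E, ℝ)}
    (hK : IsCompact K) (F : C(K × (D × E), ℝ)) {ε : ℝ} (hε : 0 < ε) :
    ∃ (J : ℕ) (c : Fin J → ℝ) (p : Fin J → Fin (m + r) → ℝ) (ψ : Fin J → C(D × E, ℝ)),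
      ∀ (ρ : K) (z : D × E), |F (ρ, z) - ∑ j, c j *
        Real.exp (p j ⬝ᵥ coord z + ∫ w, ρ.1 w * ψ j w ∂lebesgueProd D E)| ≤ ε := by
  have := isCompact_iff_compactSpace.1 hK
  obtain ⟨⟨G, hG⟩, hGF⟩ :=
    ContinuousMap.exists_mem_subalgebra_near_continuousMap_of_separatesPoints (expAlgebra K)
      (expAlgebra_separatesPoints hD hE K) F ε hε
  obtain ⟨J, c, g, rfl⟩ := Submodule.mem_span_set'.1 (show G ∈ Submodule.span ℝ _ from hG)
  choose p hp using fun j => (g j).2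
  refine ⟨J, c, fun j => (p j).1, fun j => (p j).2, fun ρ z => ?_⟩
  have h := (ContinuousMap.norm_coe_le_norm _ (ρ, z)).trans hGF.le
  rw [ContinuousMap.sub_apply, Real.norm_eq_abs, abs_sub_comm] at h
  simpa [← hp, expFun] using h

/-- The conditioning operator as a jointly continuous function of the density and the point. -/
def conditioningOn {δ : ℝ} (hδ : 0 < δ) {K : Set C(D × E, ℝ)} (hK : IsCompact K)
    (hKδ : K ⊆ densitiesGE D E δ) : C(K × (D × E), ℝ) where
  toFun q := kernelConditioning hδ ⟨q.1.1, hKδ q.1.2⟩ q.2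
  continuous_toFun := by
    have := isCompact_iff_compactSpace.1 hK
    have h := continuous_parametric_integral_of_continuous (μ := lebesgueOn D)
      (f := fun (q : K × E) (x : D) => q.1.1 (x, q.2)) (by fun_prop) isCompact_univ
    simp only [Measure.restrict_univ] at h
    have h2 : Continuous fun q : K × (D × E) => marginal q.1.1 q.2.2 :=
      h.comp (f := fun q : K × (D × E) => (q.1, q.2.2)) (by fun_prop)
    have h1 : Continuous fun q : K × (D × E) => q.1.1 q.2 := by fun_prop
    exact h1.div h2 fun q => (lt_of_lt_of_le hδ ((hKδ q.1.2).2 q.2.2)).ne'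

end Density

/-! ### Neural operators of depth one -/

theorem append_dotProduct_append {a b : ℕ} (u x : Fin a → ℝ) (v y : Fin b → ℝ) :
    Fin.append u v ⬝ᵥ Fin.append x y = u ⬝ᵥ x + v ⬝ᵥ y := by
  simp [dotProduct, Fin.sum_univ_add]

theorem IsNeuralNetwork.continuous {σ : ℝ → ℝ} (hσ : Continuous σ) {a b : ℕ}
    {g : (Fin a → ℝ) → (Fin b → ℝ)} (hg : IsNeuralNetwork σ g) : Continuous g := by
  have hlayer : ∀ {a w : ℕ} (W : Matrix (Fin w) (Fin a) ℝ) (u : Fin w → ℝ),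
      Continuous fun (x : Fin a → ℝ) i => σ ((W *ᵥ x + u) i) := by
    intro a w W u
    refine continuous_pi fun i => hσ.comp ?_
    exact (continuous_apply i).comp
      ((continuous_const.matrix_mulVec continuous_id).add continuous_const)
  induction hg with
  | shallow W u V c => exact (continuous_const.matrix_mulVec (hlayer W u)).add continuous_const
  | deeper W u _ ih => exact ih.comp (hlayer W u)

section Operator

variable {m r : ℕ} {D : Compacts (EuclideanSpace ℝ (Fin m))}
  {E : Compacts (EuclideanSpace ℝ (Fin r))} {σ : ℝ → ℝ}

theorem exists_isNeuralOperator_one (hσ : Continuous σ) {s : ℝ → ℝ} (hs : s ∈ ridgeSpan σ)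
    {J : ℕ} {g : (Fin J → ℝ) → (Fin J → ℝ)} (hg : IsNeuralNetwork σ g) (c : Fin J → ℝ)
    (p : Fin J → Fin (m + r) → ℝ) (ψ : Fin J → C(D × E, ℝ)) :
    ∃ Ψ : C(D × E, ℝ) → C(D × E, ℝ), IsNeuralOperator σ 1 Ψ ∧ ∀ ρ z, Ψ ρ z = ∑ j, c j *
      g (fun j => p j ⬝ᵥ coord z + s (∫ w, s (ρ w) * ψ j w ∂lebesgueProd D E)) j := by
  have hsc := ridgeSpan_continuous hσ hs
  obtain ⟨n, γ, α, β, hsum⟩ := exists_sum_of_mem_ridgeSpan hs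
  let e := (finProdFinEquiv (m := J) (n := n)).symm
  let lift : C(D × E, ℝ) → C(D × E, Fin 1 → ℝ) := fun f => ⟨fun z _ => s (f z), by fun_prop⟩
  -- The output is constant in `z`: its units are the summands of `s` evaluated at the `J`
  -- integrals.
  let hid : C(D × E, Fin 1 → ℝ) → C(D × E, Fin (J * n) → ℝ) := fun f =>
    ContinuousMap.const _ fun k =>
      σ (α (e k).2 * (∫ w, f w 0 * ψ (e k).1 w ∂lebesgueProd D E) + β (e k).2)
  -- Row `j` adds `p j · z` to the units of index `j`, whose weighted sum is `s` of the `j`-th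
  -- integral.
  let W : Matrix (Fin J) (Fin (m + r + J * n)) ℝ := Matrix.of fun j =>
    Fin.append (p j) fun k => if (e k).1 = j then γ (e k).2 else 0
  let Q : (Fin (m + r + J * n) → ℝ) → (Fin 1 → ℝ) := fun x =>
    (Matrix.of fun _ : Fin 1 => c) *ᵥ g (W *ᵥ x + 0) + 0
  have hQ : IsNeuralNetwork σ Q := (hg.comp_affine W 0).affine_comp _ 0
  have happ : Continuous fun q : (D × E) × (Fin (J * n) → ℝ) => Fin.append (coord q.1) q.2 := by
    refine continuous_pi fun i => ?_
    refine Fin.addCases (fun i => ?_) (fun i => ?_) i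
    · simp only [Fin.append_left]
      exact (continuous_apply i).comp (continuous_coord.comp continuous_fst)
    · simp only [Fin.append_right]
      fun_prop
  let proj : C(D × E, Fin (J * n) → ℝ) → C(D × E, ℝ) := fun f =>
    ⟨fun z => Q (Fin.append (coord z) (f z)) 0, (continuous_apply 0).comp
      ((hQ.continuous hσ).comp (happ.comp (continuous_id.prodMk f.continuous)))⟩
  refine ⟨proj ∘ hid ∘ lift, ⟨one_pos, 1, J * n, lift, hid, proj, ?_, ?_, ⟨Q, hQ, fun _ _ => rfl⟩,
    rfl⟩, fun ρ z => ?_⟩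
  · refine ⟨_, (isNeuralNetwork_of_mem_ridgeSpan hs 1).comp_affine
      (Matrix.of fun _ => Fin.append 0 1) 0, fun f z => ?_⟩
    funext i
    simp only [lift, mulVec, Matrix.of_apply, append_dotProduct_append, add_zero,
      ContinuousMap.coe_mk]
    simp [dotProduct]
  · refine IsHiddenStack.snoc (L := 0) (hid := hid) .nil ⟨0, fun k => β (e k).2, J, fun _ => 1,
      fun j => ⟨fun w _ => ψ j w, by fun_prop⟩,
      fun j => ContinuousMap.const _ fun k => if (e k).1 = j then α (e k).2 else 0, fun f z k => ?_⟩
    simp [hid, dotProduct, mul_comm, add_comm]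
  · have hW : (fun j => p j ⬝ᵥ coord z + s (∫ w, s (ρ w) * ψ j w ∂lebesgueProd D E)) =
        W *ᵥ Fin.append (coord z) (hid (lift ρ) z) + 0 := by
      funext j
      simp only [W, mulVec, add_zero, Matrix.of_apply, append_dotProduct_append]
      congr 1
      simp only [dotProduct, hid, lift, ContinuousMap.const_apply, ContinuousMap.coe_mk, ite_mul,
        zero_mul]
      rw [e.sum_comp fun q : Fin J × Fin n => if q.1 = j then γ q.2 *
        σ (α q.2 * (∫ w, s (ρ w) * ψ q.1 w ∂lebesgueProd D E) + β q.2) else 0,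
        Fintype.sum_prod_type, Finset.sum_eq_single j]
      · simp [hsum (∫ w, s (ρ w) * ψ j w ∂lebesgueProd D E)]
      · intro i _ hi
        simp [hi]
      · simp
    rw [hW]
    simp [proj, Q, mulVec, dotProduct]

theorem exists_bound_of_continuous {J : ℕ} {f : Fin J → D × E → ℝ} (hf : ∀ j, Continuous (f j)) :
    ∃ C, 0 ≤ C ∧ ∀ j z, |f j z| ≤ C := by
  obtain ⟨C, hC⟩ := (isCompact_univ (X := D × E)).exists_bound_of_continuousOn
    (f := fun z j => f j z) (continuous_pi hf).continuousOn
  exact ⟨|C|, abs_nonneg C, fun j z => ((norm_le_pi_norm (fun j => f j z) j).trans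
    (hC z trivial)).trans (le_abs_self C)⟩

theorem abs_integral_mul_le {f ψ : D × E → ℝ} {a C : ℝ} (ha : ∀ w, |f w| ≤ a)
    (hC : ∀ w, |ψ w| ≤ C) :
    |∫ w, f w * ψ w ∂lebesgueProd D E| ≤ a * C * (lebesgueProd D E).real Set.univ := by
  rw [← Real.norm_eq_abs]
  refine norm_integral_le_of_norm_le_const (Filter.Eventually.of_forall fun w => ?_)
  rw [Real.norm_eq_abs, abs_mul]
  exact mul_le_mul (ha w) (hC w) (abs_nonneg _) ((abs_nonneg _).trans (ha w))

theorem exists_isNeuralOperator_near_sum_exp (hσ : Continuous σ)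
    (hσ_aff : ¬ ∃ a b : ℝ, ∀ t, σ t = a * t + b) {K : Set C(D × E, ℝ)} (hK : IsCompact K) {J : ℕ}
    (c : Fin J → ℝ) (p : Fin J → Fin (m + r) → ℝ) (ψ : Fin J → C(D × E, ℝ)) {ε : ℝ} (hε : 0 < ε) :
    ∃ Ψ : C(D × E, ℝ) → C(D × E, ℝ), IsNeuralOperator σ 1 Ψ ∧ ∀ ρ ∈ K, ∀ z,
      |∑ j, c j * Real.exp (p j ⬝ᵥ coord z + ∫ w, ρ w * ψ j w ∂lebesgueProd D E) - Ψ ρ z| ≤ ε := by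
  have hsq := ridgeLimit_sq hσ hσ_aff
  obtain ⟨C, hC0, hC⟩ := exists_bound_of_continuous fun j => (ψ j).continuous
  obtain ⟨P, hP0, hP⟩ := exists_bound_of_continuous (D := D) (E := E)
    (f := fun j z => p j ⬝ᵥ coord z) fun j => continuous_const.dotProduct continuous_coord
  obtain ⟨A, hA⟩ := hK.isBounded.exists_norm_le
  set V := (lebesgueProd D E).real Set.univ with hV
  have hV0 : 0 ≤ V := measureReal_nonneg
  set S := ∑ j, |c j| with hS
  have hS0 : 0 ≤ S := Finset.sum_nonneg fun j _ => abs_nonneg _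
  set ε' := ε / (S + 1) with hε'
  have hε'0 : 0 < ε' := by positivity
  set B := P + |A| * C * V with hB
  obtain ⟨η, hη, hu⟩ := Metric.uniformContinuousOn_iff_le.1
    ((isCompact_Icc (a := -(B + 1)) (b := B + 1)).uniformContinuousOn_of_continuous
      Real.continuous_exp.continuousOn) (ε' / 2) (by positivity)
  obtain ⟨g, hg, hgb⟩ := networkLimit_exp hsq J (B + 1) (ε' / 2) (by positivity)
  -- With `s` within `θ` of the identity, its inner use costs `θ * (C * V)` after integration and
  -- its outer use costs `θ`. The cap `1` keeps the perturbed integrals within `|A| * C * V + C *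
  -- V`, where `s` is still controlled.
  set θ := min 1 (min η 1 / (1 + C * V)) with hθ
  have hCV : 0 ≤ C * V := by positivity
  have hθ0 : 0 < θ := by positivity
  have hθ1 : θ + θ * (C * V) ≤ min η 1 := by
    have : θ ≤ min η 1 / (1 + C * V) := min_le_right _ _
    rw [le_div_iff₀ (by positivity)] at this
    linarith
  obtain ⟨s, hs, hsb⟩ := ridgeLimit_affine hsq 1 0 (|A| + |A| * C * V + C * V) θ hθ0
  simp only [one_mul, add_zero] at hsb
  have hsc := ridgeSpan_continuous hσ hs
  obtain ⟨Ψ, hΨ, hΨe⟩ := exists_isNeuralOperator_one hσ hs hg c p ψ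
  have hACV : 0 ≤ |A| * C * V := by positivity
  refine ⟨Ψ, hΨ, fun ρ hρ z => ?_⟩
  have hρA : ∀ w, |ρ w| ≤ |A| := fun w =>
    (ρ.norm_coe_le_norm w).trans ((hA ρ hρ).trans (le_abs_self A))
  have hℓ : ∀ j, |∫ w, ρ w * ψ j w ∂lebesgueProd D E| ≤ |A| * C * V := fun j =>
    abs_integral_mul_le hρA (hC j)
  have hℓs : ∀ j, |(∫ w, ρ w * ψ j w ∂lebesgueProd D E) -
      ∫ w, s (ρ w) * ψ j w ∂lebesgueProd D E| ≤ θ * (C * V) := fun j => by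
    rw [← integral_sub (integrable_of_continuous (by fun_prop))
      (integrable_of_continuous (by fun_prop))]
    simp only [← sub_mul]
    rw [← mul_assoc]
    exact abs_integral_mul_le (fun w => hsb _ (by linarith [hρA w])) (hC j)
  have hℓb : ∀ j, |s (∫ w, s (ρ w) * ψ j w ∂lebesgueProd D E) -
      ∫ w, ρ w * ψ j w ∂lebesgueProd D E| ≤ min η 1 := fun j => by
    have h1 := hℓ j
    have h2 := hℓs j
    have h3 : θ * (C * V) ≤ C * V := mul_le_of_le_one_left hCV (min_le_left _ _)
    have h4 := hsb (∫ w, s (ρ w) * ψ j w ∂lebesgueProd D E) (by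
      have := abs_nonneg A
      rw [abs_le] at h1 h2 ⊢
      constructor <;> linarith)
    rw [abs_le] at *
    constructor <;> linarith
  set t : Fin J → ℝ := fun j => p j ⬝ᵥ coord z + ∫ w, ρ w * ψ j w ∂lebesgueProd D E with ht
  set t' : Fin J → ℝ := fun j => p j ⬝ᵥ coord z +
    s (∫ w, s (ρ w) * ψ j w ∂lebesgueProd D E) with ht'
  have htt : ∀ j, |t j - t' j| ≤ min η 1 := fun j => by
    rw [abs_sub_comm, ht, ht', add_sub_add_left_eq_sub]
    exact hℓb j
  have htB : ∀ j, |t j| ≤ B := fun j =>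
    (abs_add_le _ _).trans (add_le_add (hP j z) (hℓ j))
  have htB' : ∀ j, |t' j| ≤ B + 1 := fun j => by
    have h1 := (htt j).trans (min_le_right _ _)
    have h2 := htB j
    rw [abs_le] at *
    constructor <;> linarith
  have hterm : ∀ j, |Real.exp (t j) - g t' j| ≤ ε' := fun j => by
    have h1 := hu (t j) (abs_le.1 ((htB j).trans (by linarith))) (t' j) (abs_le.1 (htB' j))
      ((htt j).trans (min_le_left _ _))
    rw [Real.dist_eq] at h1
    have h2 := hgb t' htB' j
    have h3 := abs_sub_le (Real.exp (t j)) (Real.exp (t' j)) (g t' j)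
    linarith
  rw [hΨe, ← Finset.sum_sub_distrib]
  calc _ ≤ ∑ j, |c j| * ε' := by
        refine (Finset.abs_sum_le_sum_abs _ _).trans (Finset.sum_le_sum fun j _ => ?_)
        rw [← mul_sub, abs_mul]
        exact mul_le_mul_of_nonneg_left (hterm j) (abs_nonneg _)
    _ = S * ε' := by rw [← Finset.sum_mul]
    _ ≤ (S + 1) * ε' := by gcongr; linarith
    _ = ε := by rw [hε']; field_simp

end Operator

end CondOp

end

theorem mainTheorem1 {m r : ℕ}
    (D : TopologicalSpace.Compacts (EuclideanSpace ℝ (Fin m)))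
    (E : TopologicalSpace.Compacts (EuclideanSpace ℝ (Fin r)))
    (hD : CondOp.HasLipschitzBoundary (D : Set (EuclideanSpace ℝ (Fin m))))
    (hE : CondOp.HasLipschitzBoundary (E : Set (EuclideanSpace ℝ (Fin r))))
    (σ : ℝ → ℝ) (hσ : Continuous σ)
    (hσ_aff : ¬ ∃ a b : ℝ, ∀ t, σ t = a * t + b)
    (δ : ℝ) (hδ : 0 < δ)
    (K : Set C(D × E, ℝ)) (hK : IsCompact K) (hKδ : K ⊆ CondOp.densitiesGE D E δ)
    (ε : ℝ) (hε : 0 < ε) :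
    ∃ (L : ℕ) (Ψ : C(D × E, ℝ) → C(D × E, ℝ)), CondOp.IsNeuralOperator σ L Ψ ∧
      ∀ (ρ : C(D × E, ℝ)) (hρ : ρ ∈ K),
        ‖CondOp.kernelConditioning hδ ⟨ρ, hKδ hρ⟩ - Ψ ρ‖ ≤ ε := by
  obtain ⟨J, c, p, ψ, h1⟩ := CondOp.exists_sum_exp_near hD hE hK
    (CondOp.conditioningOn hδ hK hKδ) (half_pos hε)
  obtain ⟨Ψ, hΨ, h2⟩ := CondOp.exists_isNeuralOperator_near_sum_exp hσ hσ_aff hK c p ψ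
    (half_pos hε)
  refine ⟨1, Ψ, hΨ, fun ρ hρ => (ContinuousMap.norm_le _ hε.le).2 fun z => ?_⟩
  have h3 := h1 ⟨ρ, hρ⟩ z
  rw [ContinuousMap.sub_apply, Real.norm_eq_abs]
  refine (abs_sub_le _ _ _).trans ((add_le_add h3 (h2 ρ hρ z)).trans ?_)
  linarith
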